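/- For $n\in\mathbb N$ let $d_n(\sigma,\tau)=\frac1n|\{i:\sigma(i)\neq\tau(i)\}|$ be the normalized Hamming metric on $\mathrm{Sym}(n)$. For a sequence $(k_n)_n$ of natural numbers, let $\mathrm{Sym}[(k_n)_n]$ be the metric reduced product, i.e. the quotient of $\prod_n\mathrm{Sym}(k_n)$ by the normal subgroup $\{(a_n)_n:\limsup_n d_{k_n}(a_n,1)=0\}$; for an ultrafilter $\mathcal U$ on $\mathbb N$ let $\prod_n\mathrm{Sym}(k_n)/\mathcal U$ be the metric ultraproduct, i.e. the quotient by $\{(a_n)_n:\lim_{n\to\mathcal U}d_{k_n}(a_n,1)=0\}$. For $S\subseteq\mathbb N$ and $a=[(a_n)_n],\,b=[(b_n)_n]$ in $\mathrm{Sym}[(k_n)_n]$ put $d^S(a,b)=\limsup_{n\in S}d_{k_n}(a_n,b_n)$, and write $a=_Sb$ if $d^S(a,b)=0$. Let $\partial\beta\mathbb N=\beta\mathbb N\setminus\mathbb N$ be the space of nonprincipal ultrafilters on $\mathbb N$. An autohomeomorphism $\theta$ of $\partial\beta\mathbb N$ is identified, by Stone duality, with the automorphism of the Boolean algebra $\mathcal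 P(\mathbb N)/\mathrm{Fin}$, also denoted $\theta$, determined by $\theta(S)\in\mathcal U\Leftrightarrow S\in\theta(\mathcal U)$ for all $S\subseteq\mathbb N$ and $\mathcal U\in\partial\beta\mathbb N$; the relation $=_{\theta(S)}$ does not depend on the chosen representative of $\theta(S)$. **Theorem.** Let $(k_n)_n$ and $(l_n)_n$ be sequences of natural numbers with $\lim_n k_n=\lim_n l_n=\infty$. For every group isomorphism $\varphi:\mathrm{Sym}[(k_n)_n]\to\mathrm{Sym}[(l_n)_n]$ there is an autohomeomorphism $\theta$ of $\partial\beta\mathbb N$ such that 1. for all $a,b\in\mathrm{Sym}[(k_n)_n]$ and every infinite $S\subseteq\mathbb N$, $a=_Sb\Leftrightarrow\varphi(a)=_{\theta(S)}\varphi(b)$; 2. for every nonprincipal ultrafilter $\mathcal U$ on $\mathbb N$, $\varphi$ induces a group isomorphism $\varphi_{\mathcal U}:\prod_n\mathrm{Sym}(k_n)/\mathcal U\to\prod_n\mathrm{Sym}(l_n)/\theta^{-1}(\mathcal U)$, i.e. whenever $\varphi([(a_n)_n])=[(b_n)_n]$, $\varphi_{\mathcal U}$ maps the class of $(a_n)_n$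 to the class of $(b_n)_n$. -/

import Mathlib

open Filter Topology

noncomputable section

namespace SymReduced

/-- The normalized Hamming distance on `Sym(n)`, realised as `Equiv.Perm (Fin n)`. -/
def normHamming {n : ℕ} (σ τ : Equiv.Perm (Fin n)) : ℝ :=
  ((Finset.univ.filter fun i => σ i ≠ τ i).card : ℝ) / n

lemma normHamming_nonneg {n : ℕ} (σ τ : Equiv.Perm (Fin n)) : 0 ≤ normHamming σ τ := by
  unfold normHamming; positivity

lemma normHamming_le_one {n : ℕ} (σ τ : Equiv.Perm (Fin n)) : normHamming σ τ ≤ 1 := by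
  unfold normHamming
  apply div_le_one_of_le₀ _ (Nat.cast_nonneg n)
  exact_mod_cast (Finset.card_le_univ _).trans (by simp)

lemma normHamming_self {n : ℕ} (σ : Equiv.Perm (Fin n)) : normHamming σ σ = 0 := by
  simp [normHamming]

lemma normHamming_comm {n : ℕ} (σ τ : Equiv.Perm (Fin n)) :
    normHamming σ τ = normHamming τ σ := by
  simp only [normHamming, ne_comm]

lemma normHamming_triangle {n : ℕ} (σ τ ρ : Equiv.Perm (Fin n)) :
    normHamming σ ρ ≤ normHamming σ τ + normHamming τ ρ := by
  unfold normHamming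
  rw [← add_div]
  gcongr
  norm_cast
  refine le_trans (Finset.card_le_card ?_) (Finset.card_union_le _ _)
  intro i
  simp only [Finset.mem_filter, Finset.mem_univ, true_and, Finset.mem_union]
  intro h
  by_contra! hc
  exact h (hc.1.trans hc.2)

lemma normHamming_mul_left {n : ℕ} (ρ σ τ : Equiv.Perm (Fin n)) :
    normHamming (ρ * σ) (ρ * τ) = normHamming σ τ := by
  simp [normHamming]

lemma normHamming_mul_right {n : ℕ} (σ τ ρ : Equiv.Perm (Fin n)) :
    normHamming (σ * ρ) (τ * ρ) = normHamming σ τ := by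
  unfold normHamming
  congr 2
  refine Finset.card_equiv ρ fun i => ?_
  rw [Finset.mem_filter, Finset.mem_filter]
  simp

/-- The full product `∏ₙ Sym(kₙ)`. -/
abbrev SymProd (k : ℕ → ℕ) : Type := ∀ n, Equiv.Perm (Fin (k n))

lemma isBoundedUnder_normHamming {k : ℕ → ℕ} (F : Filter ℕ) (a b : SymProd k) :
    F.IsBoundedUnder (· ≤ ·) fun n => normHamming (a n) (b n) :=
  isBoundedUnder_of ⟨1, fun _ => normHamming_le_one _ _⟩

lemma isBoundedUnder_ge_normHamming {k : ℕ → ℕ} (F : Filter ℕ) (a b : SymProd k) :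
    F.IsBoundedUnder (· ≥ ·) fun n => normHamming (a n) (b n) :=
  isBoundedUnder_of ⟨0, fun _ => normHamming_nonneg _ _⟩

lemma limsup_normHamming_eq_zero_iff {k : ℕ → ℕ} (F : Filter ℕ) (a b : SymProd k) :
    limsup (fun n => normHamming (a n) (b n)) F = 0 ↔
      Tendsto (fun n => normHamming (a n) (b n)) F (𝓝 0) := by
  rcases F.eq_or_neBot with rfl | hF
  · simp [limsup, limsSup]
  constructor
  · intro h
    refine tendsto_of_le_liminf_of_limsup_le ?_ h.le
      (isBoundedUnder_normHamming F a b) (isBoundedUnder_ge_normHamming F a b)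
    exact le_liminf_of_le (isBoundedUnder_normHamming F a b).isCoboundedUnder_ge
      (Eventually.of_forall fun n => normHamming_nonneg _ _)
  · intro h
    exact h.limsup_eq

/-- The sequences `(aₙ)` with `limsup d(aₙ, 1) = 0` along the filter `F`, as a subgroup
of `∏ₙ Sym(kₙ)`. When `F` is an ultrafilter, the limsup is the limit along `F`. -/
def nullSubgroup (k : ℕ → ℕ) (F : Filter ℕ) : Subgroup (SymProd k) where
  carrier := {a | limsup (fun n => normHamming (a n) 1) F = 0}
  one_mem' := by
    refine (limsup_normHamming_eq_zero_iff F 1 1).2 ?_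
    simp only [Pi.one_apply, normHamming_self]
    exact tendsto_const_nhds
  mul_mem' := by
    intro a b ha hb
    have ha := (limsup_normHamming_eq_zero_iff F a 1).1 ha
    have hb := (limsup_normHamming_eq_zero_iff F b 1).1 hb
    refine (limsup_normHamming_eq_zero_iff F (a * b) 1).2 ?_
    refine squeeze_zero (fun n => normHamming_nonneg _ _) (fun n => ?_) (by simpa using ha.add hb)
    refine (normHamming_triangle _ (b n) _).trans (le_of_eq ?_)
    congr 1
    simpa using normHamming_mul_right (a n) 1 (b n)
  inv_mem' := by
    intro a ha
    refine Eq.trans ?_ ha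
    congr 1
    funext n
    have := normHamming_mul_left (a n) (a n)⁻¹ 1
    rw [normHamming_comm]
    simpa [normHamming_comm] using this.symm

lemma mem_nullSubgroup_iff {k : ℕ → ℕ} {F : Filter ℕ} {a : SymProd k} :
    a ∈ nullSubgroup k F ↔ Tendsto (fun n => normHamming (a n) 1) F (𝓝 0) :=
  limsup_normHamming_eq_zero_iff F a 1

instance nullSubgroup_normal (k : ℕ → ℕ) (F : Filter ℕ) : (nullSubgroup k F).Normal where
  conj_mem := by
    intro a ha g
    refine Eq.trans ?_ ha
    congr 1
    funext n
    have h1 := normHamming_mul_right (g n * a n) (g n) (g n)⁻¹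
    have h2 := normHamming_mul_left (g n) (a n) 1
    simp only [mul_inv_cancel, mul_one] at h1 h2
    exact h1.trans h2

/-- The metric reduced product `Sym[(kₙ)ₙ]`. -/
abbrev ReducedProd (k : ℕ → ℕ) : Type := SymProd k ⧸ nullSubgroup k atTop

/-- The metric ultraproduct `∏ₙ Sym(kₙ) / U`. -/
abbrev UltraProd (k : ℕ → ℕ) (U : Ultrafilter ℕ) : Type := SymProd k ⧸ nullSubgroup k U

lemma limsup_le_of_tendsto {k : ℕ → ℕ} (F : Filter ℕ) (a b a' b' : SymProd k)
    (ha : Tendsto (fun n => normHamming (a n) (a' n)) F (𝓝 0))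
    (hb : Tendsto (fun n => normHamming (b n) (b' n)) F (𝓝 0)) :
    limsup (fun n => normHamming (a n) (b n)) F ≤ limsup (fun n => normHamming (a' n) (b' n)) F := by
  rcases F.eq_or_neBot with rfl | hF
  · simp [limsup, limsSup]
  refine le_of_forall_pos_le_add fun ε hε => ?_
  have hlt : ∀ᶠ n in F, normHamming (a' n) (b' n) <
      limsup (fun n => normHamming (a' n) (b' n)) F + ε / 3 :=
    eventually_lt_of_limsup_lt (by linarith) (isBoundedUnder_normHamming F a' b')
  refine limsup_le_of_le (isBoundedUnder_ge_normHamming F a b).isCoboundedUnder_le ?_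
  filter_upwards [hlt, ha.eventually_lt_const (by linarith : (0 : ℝ) < ε / 3),
    hb.eventually_lt_const (by linarith : (0 : ℝ) < ε / 3)] with n h1 h2 h3
  have t1 := normHamming_triangle (a n) (a' n) (b n)
  have t2 := normHamming_triangle (a' n) (b' n) (b n)
  rw [normHamming_comm (b' n) (b n)] at t2
  linarith

lemma tendsto_of_leftRel {k : ℕ → ℕ} {a a' : SymProd k}
    (h : QuotientGroup.leftRel (nullSubgroup k atTop) a a') :
    Tendsto (fun n => normHamming (a n) (a' n)) atTop (𝓝 0) := by
  refine (mem_nullSubgroup_iff.1 (QuotientGroup.leftRel_apply.1 h)).congr fun n => ?_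
  have := normHamming_mul_left (a n) ((a n)⁻¹ * a' n) 1
  rw [normHamming_comm (a n)]
  simpa using this.symm

/-- The pseudometric `d^S(a, b) = limsup_{n ∈ S} d(aₙ, bₙ)` on `Sym[(kₙ)ₙ]`. -/
def distOn {k : ℕ → ℕ} (S : Set ℕ) (a b : ReducedProd k) : ℝ :=
  Quotient.liftOn₂ a b (fun a b => limsup (fun n => normHamming (a n) (b n)) (atTop ⊓ 𝓟 S)) (by
    intro a b a' b' ha hb
    have ha := (tendsto_of_leftRel ha).mono_left (inf_le_left : atTop ⊓ 𝓟 S ≤ atTop)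
    have hb := (tendsto_of_leftRel hb).mono_left (inf_le_left : atTop ⊓ 𝓟 S ≤ atTop)
    refine le_antisymm (limsup_le_of_tendsto _ a b a' b' ha hb)
      (limsup_le_of_tendsto _ a' b' a b ?_ ?_)
    · simpa only [normHamming_comm] using ha
    · simpa only [normHamming_comm] using hb)

/-- The relation `a =_S b`. -/
def EqOn {k : ℕ → ℕ} (S : Set ℕ) (a b : ReducedProd k) : Prop := distOn S a b = 0

/-- The Stone–Čech boundary `∂βℕ = βℕ \ ℕ`: the nonprincipal ultrafilters on `ℕ` with the
subspace topology inherited from `βℕ = Ultrafilter ℕ`. -/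
abbrev BetaBoundary : Type := ((Set.range (pure : ℕ → Ultrafilter ℕ))ᶜ : Set (Ultrafilter ℕ))

/-- The Boolean algebra `𝒫(ℕ)/Fin`: predicates on `ℕ` up to finite changes, ordered by inclusion
up to a finite set. -/
abbrev PowModFin : Type := (cofinite : Filter ℕ).Germ Prop

/-- The class in `𝒫(ℕ)/Fin` of a subset of `ℕ`. -/
def PowModFin.mk (S : Set ℕ) : PowModFin := Germ.ofFun fun n => n ∈ S

/-- The automorphism `Θ` of `𝒫(ℕ)/Fin` corresponds under Stone duality to the autohomeomorphism
`θ` of `∂βℕ`: when `Θ[S] = [T]`, the clopen set of `T` is the preimage under `θ` of that of `S`. -/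
def IsStoneDual (θ : BetaBoundary ≃ₜ BetaBoundary) (Θ : PowModFin ≃o PowModFin) : Prop :=
  ∀ S T : Set ℕ, Θ (PowModFin.mk S) = PowModFin.mk T →
    ∀ U : BetaBoundary, T ∈ U.1 ↔ S ∈ (θ U).1

end SymReduced

end

/-!
For a nonprincipal ultrafilter `U`, let `ultraKernel k U` be the kernel of the map from the metric
reduced product `Sym[(kₙ)ₙ]` onto the metric ultraproduct along `U`. Both parts of the theorem
follow once every isomorphism `φ` is known to permute these kernels, since `a =_S b` holds exactly
when `b⁻¹ a` lies in `ultraKernel k U` for all nonprincipal `U ∋ S`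
(`eqOn_iff_forall_mem_ultraKernel`).

The kernels are recognised group-theoretically: every proper normal subgroup of the reduced product
is contained in one of them (`exists_le_nullSubgroup`). As distinct kernels are incomparable, they
are precisely the maximal proper normal subgroups, so `φ` induces a bijection `e` of `∂βℕ`
(`exists_equiv_ultraKernel`). The ultrafilters containing `S` are those whose kernel omits
an element rotating all points at the indices in `S`, so `e` maps clopen sets to clopen sets
(`exists_forall_mem_iff`), and `θ = e⁻¹` is a homeomorphism with a Stone dual
(`exists_isStoneDual`).

To find the ultrafilter for a proper normal subgroup `N`, consider the ideal of all sets `S ⊆ ℕ`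
such that `N` contains everything supported on `S`, and take an ultrafilter avoiding it. That `N`
lies in its kernel amounts to the following (`mem_of_support_subset`): if `a ∈ N` stays at distance
at least `ε` from the identity along `S`, then `N` contains all `g` supported on `S`. This is a
uniform simplicity property of finite symmetric groups, obtained in three steps. A permutation is a
product of two involutions (`exists_involutions_mul_eq`). An involution is, up to one transposition,
the product of two conjugate involutions of at most half its support (`exists_split_involution`), so
it suffices to treat involutions of small support. An involution whose support is at most a third of
that of `σ` is, up to one transposition, conjugate to a commutator of `σ`
(`exists_conj_commutator`). The single transpositions form null sequences because `kₙ → ∞`.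
-/

namespace SymReduced

/-! ### Involutions and commutators in finite symmetric groups -/

section Perm

open Equiv Equiv.Perm

/-- Every permutation is a product of two involutions. On the cycle through a base point `r`, the
reflection `σ ^ i r ↦ σ ^ (-i) r` conjugates `σ` to its inverse; these reflections together form
an involution `ρ`, and `ρ * σ` is an involution as well. -/
lemma exists_involutions_mul_eq {α : Type*} (σ : Perm α) :
    ∃ ρ π : Perm α, ρ * ρ = 1 ∧ π * π = 1 ∧ σ = ρ * π ∧
      ∀ x, σ x = x → ρ x = x ∧ π x = x := by
  let s := SameCycle.setoid σ
  let r : α → α := fun x => (Quotient.mk s x).out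
  have hr : ∀ x, ∃ i : ℤ, (σ ^ i) (r x) = x := fun x => Quotient.exact (Quotient.mk s x).out_eq
  have hrz : ∀ x (i : ℤ), r ((σ ^ i) x) = r x := fun x i =>
    congrArg Quotient.out (Quotient.sound (s := s) (⟨-i, by simp⟩ : SameCycle σ ((σ ^ i) x) x))
  choose i hi using hr
  let f : α → α := fun x => (σ ^ (-i x)) (r x)
  -- The value of `f` does not depend on the exponent chosen to reach `x` from the base point.
  have key : ∀ x (j : ℤ), f ((σ ^ j) (r x)) = (σ ^ (-j)) (r x) := by
    intro x j
    have h1 : r ((σ ^ j) (r x)) = r x := by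
      rw [hrz]
      conv_rhs => rw [← hi x, hrz]
    have h2 := hi ((σ ^ j) (r x))
    rw [h1] at h2
    simp only [f]
    rw [h1]
    set m := i ((σ ^ j) (r x))
    have h3 : (σ ^ (-m)) ((σ ^ (-j)) ((σ ^ m) (r x))) = (σ ^ (-m)) ((σ ^ (-j)) ((σ ^ j) (r x))) := by
      rw [h2]
    rw [← Perm.mul_apply, ← Perm.mul_apply, ← Perm.mul_apply, ← Perm.mul_apply, ← zpow_add,
      ← zpow_add, ← zpow_add] at h3
    have e1 : -m + -j + m = -j := by ring
    have e2 : -m + -j + j = -m := by ring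
    rw [e1, e2] at h3
    exact h3.symm
  have hf : Function.Involutive f := by
    intro x
    have h1 : f x = (σ ^ (-i x)) (r x) := rfl
    rw [h1, key, neg_neg, hi]
  have hfs : ∀ x, σ (f (σ x)) = f x := by
    intro x
    have h1 : σ x = (σ ^ (1 + i x)) (r x) := by
      rw [zpow_add, Perm.mul_apply, hi, zpow_one]
    rw [h1, key, ← Perm.mul_apply]
    nth_rewrite 1 [← zpow_one σ]
    rw [← zpow_add]
    congr 2
    ring
  have hfx : ∀ x, σ x = x → f x = x := by
    intro x hx
    have hz : ∀ m : ℤ, (σ ^ m) x = x := fun m => zpow_apply_eq_self_of_apply_eq_self hx m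
    have h2 : r x = x := by
      have := congrArg (σ ^ (-i x)) (hi x)
      rwa [hz, ← Perm.mul_apply, ← zpow_add, neg_add_cancel, zpow_zero, Perm.one_apply] at this
    simp only [f, h2, hz]
  refine ⟨hf.toPerm, hf.toPerm * σ, ?_, ?_, ?_, fun x hx => ⟨hfx x hx, ?_⟩⟩
  · ext x; exact hf x
  · ext x
    change f (σ (f (σ x))) = x
    rw [hfs, hf x]
  · ext x
    change σ x = f (f (σ x))
    rw [hf]
  · change f (σ x) = x
    rw [hx, hfx x hx]

variable {α : Type*} [DecidableEq α]

lemma cycleType_eq_of_involutions [Fintype α] {s t : Perm α} (hs : s * s = 1) (ht : t * t = 1)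
    (h : s.support.card = t.support.card) : s.cycleType = t.cycleType := by
  have hs' := cycleType_of_pow_prime_eq_one (p := 2) (σ := s) (by rw [pow_two, hs])
  have ht' := cycleType_of_pow_prime_eq_one (p := 2) (σ := t) (by rw [pow_two, ht])
  have h1 := sum_cycleType s
  have h2 := sum_cycleType t
  rw [hs'] at h1
  rw [ht'] at h2
  simp only [Multiset.sum_replicate, smul_eq_mul] at h1 h2
  rw [hs', ht']
  congr 1
  omega

/-- The involution agreeing with the involution `t` on `B ∪ t B` and fixing all other points. -/
def involutionOn (t : Perm α) (ht : Function.Involutive t) (B : Finset α) : Perm α :=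
  Function.Involutive.toPerm (fun x => if x ∈ B ∨ t x ∈ B then t x else x) (by
    intro x
    have := ht x
    grind)

lemma involutionOn_apply (t : Perm α) (ht : Function.Involutive t) (B : Finset α) (x : α) :
    involutionOn t ht B x = if x ∈ B ∨ t x ∈ B then t x else x := rfl

lemma involutionOn_mul_self (t : Perm α) (ht : Function.Involutive t) (B : Finset α) :
    involutionOn t ht B * involutionOn t ht B = 1 := by
  ext x
  exact Function.Involutive.toPerm_involutive _ x

variable [Fintype α]

lemma card_support_involutionOn (t : Perm α) (ht : Function.Involutive t) (B : Finset α)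
    (hB : ∀ x ∈ B, t x ∉ B) : (involutionOn t ht B).support.card = 2 * B.card := by
  have h1 : (involutionOn t ht B).support = B ∪ B.image t := by
    ext x
    have h2 : x ∈ B.image t ↔ t x ∈ B := by
      rw [Finset.mem_image]
      constructor
      · rintro ⟨y, hy, rfl⟩
        rwa [ht y]
      · exact fun h => ⟨t x, h, ht x⟩
    have h3 := ht x
    rw [mem_support, involutionOn_apply, Finset.mem_union, h2]
    grind
  have h2 : _root_.Disjoint B (B.image t) := by
    rw [Finset.disjoint_left]
    intro x hx h
    obtain ⟨y, hy, rfl⟩ := Finset.mem_image.1 h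
    exact hB y hy hx
  rw [h1, Finset.card_union_of_disjoint h2, Finset.card_image_of_injective _ t.injective, two_mul]

/-- An involution splits, up to one leftover transposition, into two disjoint conjugate
involutions. -/
lemma exists_split_involution {α : Type*} [Fintype α] [LinearOrder α] (t : Perm α)
    (ht : t * t = 1) :
    ∃ t₁ t₂ u : Perm α, t = t₁ * t₂ * u ∧ t₁ * t₁ = 1 ∧ t₂ * t₂ = 1 ∧
      t₁.Disjoint t₂ ∧ t₁.support.card = t₂.support.card ∧
      2 * t₁.support.card ≤ t.support.card ∧ u.support.card ≤ 2 := by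
  have ht' : Function.Involutive t := fun x => by rw [← Perm.mul_apply, ht, Perm.one_apply]
  -- `R` contains one point of each 2-cycle of `t`.
  let R : Finset α := Finset.univ.filter fun x => x < t x
  have hR : ∀ x ∈ R, t x ∉ R := by
    intro x hx h
    simp only [R, Finset.mem_filter, Finset.mem_univ, true_and, ht' x] at hx h
    exact lt_asymm hx h
  have hR' : ∀ x, x ∈ R ∨ t x ∈ R ∨ t x = x := by
    intro x
    simp only [R, Finset.mem_filter, Finset.mem_univ, true_and, ht' x]
    rcases lt_trichotomy x (t x) with h | h | h
    · exact Or.inl h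
    · exact Or.inr (Or.inr h.symm)
    · exact Or.inr (Or.inl h)
  obtain ⟨R₁, h1, c1⟩ := Finset.exists_subset_card_eq (s := R) (n := R.card / 2) (by omega)
  obtain ⟨R₂, h2, c2⟩ := Finset.exists_subset_card_eq (s := R \ R₁) (n := R.card / 2) (by
    rw [Finset.card_sdiff_of_subset h1]; omega)
  let R₃ := (R \ R₁) \ R₂
  have c3 : R₃.card ≤ 1 := by
    rw [Finset.card_sdiff_of_subset h2, Finset.card_sdiff_of_subset h1]; omega
  have hsub : ∀ B ⊆ R, ∀ x ∈ B, t x ∉ B := fun B hB x hx h => hR x (hB hx) (hB h)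
  have h2R : R₂ ⊆ R := h2.trans Finset.sdiff_subset
  have h3R : R₃ ⊆ R := Finset.sdiff_subset.trans Finset.sdiff_subset
  have cR : t.support.card = 2 * R.card := by
    rw [← card_support_involutionOn t ht' R hR]
    congr 2
    ext x
    have := hR' x
    rw [involutionOn_apply]
    grind
  refine ⟨involutionOn t ht' R₁, involutionOn t ht' R₂, involutionOn t ht' R₃, ?_,
    involutionOn_mul_self _ _ _, involutionOn_mul_self _ _ _, ?_, ?_, ?_, ?_⟩
  · ext x
    have e := ht' x
    have a1 := hR x
    have a2 := hR (t x)
    have a3 := hR' x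
    have b1 := @h1 x
    have b2 := @h1 (t x)
    have d1 := @h2 x
    have d2 := @h2 (t x)
    simp only [Perm.mul_apply, involutionOn_apply, R₃, Finset.mem_sdiff] at *
    grind
  · intro x
    have e := ht' x
    have a1 := hR x
    have a2 := hR (t x)
    have b1 := @h1 x
    have b2 := @h1 (t x)
    have d1 := @h2 x
    have d2 := @h2 (t x)
    simp only [involutionOn_apply, Finset.mem_sdiff] at *
    grind
  · rw [card_support_involutionOn _ _ _ (hsub _ h1), card_support_involutionOn _ _ _ (hsub _ h2R),
      c1, c2]
  · rw [card_support_involutionOn _ _ _ (hsub _ h1), cR, c1]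
    omega
  · rw [card_support_involutionOn _ _ _ (hsub _ h3R)]
    omega

/-- A permutation displaces some set comprising at least a third of its support: a maximal
displaced set `A` satisfies `supp σ ⊆ A ∪ σ A ∪ σ⁻¹ A`. -/
lemma exists_displaced_finset (σ : Perm α) :
    ∃ A : Finset α, (∀ x ∈ A, σ x ∉ A) ∧ σ.support.card ≤ 3 * A.card := by
  obtain ⟨A, hA⟩ := (Set.toFinite {A : Finset α | ∀ x ∈ A, σ x ∉ A}).exists_maximal
    ⟨∅, by simp⟩
  refine ⟨A, hA.1, ?_⟩
  have hsub : σ.support ⊆ A ∪ A.image σ ∪ A.image σ.symm := by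
    intro x hx
    rw [mem_support] at hx
    by_contra hn
    simp only [Finset.mem_union, Finset.mem_image, not_or, not_exists, not_and] at hn
    obtain ⟨⟨h1, h2⟩, h3⟩ := hn
    refine h1 (hA.2 (y := insert x A) ?_ (Finset.subset_insert _ _) (Finset.mem_insert_self _ _))
    intro y hy hσ
    have h4 := hA.1 y
    have h5 := h2 y
    have h6 := h3 (σ x)
    rw [σ.symm_apply_apply] at h6
    grind
  calc σ.support.card ≤ _ := Finset.card_le_card hsub
    _ ≤ (A.card + (A.image σ).card) + (A.image σ.symm).card :=
      (Finset.card_union_le _ _).trans (by gcongr; exact Finset.card_union_le _ _)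
    _ ≤ (A.card + A.card) + A.card :=
      add_le_add (add_le_add le_rfl Finset.card_image_le) Finset.card_image_le
    _ = _ := by ring

lemma exists_conj_support_subset (s : Perm α) (A : Finset α) (h : s.support.card ≤ A.card) :
    ∃ g : Perm α, (g * s * g⁻¹).support ⊆ A := by
  obtain ⟨B, hB, cB⟩ := Finset.exists_subset_card_eq h
  let e : {x // x ∈ s.support} ≃ {x // x ∈ B} := Finset.equivOfCardEq cB.symm
  refine ⟨e.extendSubtype, fun x hx => hB ?_⟩
  rw [support_conj, Finset.mem_map] at hx
  obtain ⟨y, hy, rfl⟩ := hx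
  exact e.extendSubtype_mem y hy

/-- An involution whose support is at most a third of that of `σ` is, up to one transposition,
conjugate to a commutator `σ * c * σ⁻¹ * c⁻¹`. If `c` is supported on a set displaced by `σ`, then
this commutator is the product of the disjoint permutations `σ * c * σ⁻¹` and `c⁻¹`. -/
lemma exists_conj_commutator {α : Type*} [Fintype α] [LinearOrder α] (σ t : Perm α)
    (ht : t * t = 1) (h : 3 * t.support.card ≤ σ.support.card) :
    ∃ g c u : Perm α, t = g * (σ * c * σ⁻¹ * c⁻¹) * g⁻¹ * u ∧ u.support.card ≤ 2 := by
  obtain ⟨t₁, t₂, u, htu, h1, h2, hd, hc, hle, hu⟩ := exists_split_involution t ht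
  obtain ⟨A, hA, cA⟩ := exists_displaced_finset σ
  obtain ⟨w, hw⟩ := exists_conj_support_subset t₁ A (by omega)
  set c := w * t₁ * w⁻¹ with hcdef
  have hdis : (σ * c * σ⁻¹).Disjoint c⁻¹ := by
    rw [disjoint_iff_disjoint_support, support_inv, support_conj, Finset.disjoint_left]
    intro x hx hx'
    obtain ⟨y, hy, rfl⟩ := Finset.mem_map.1 hx
    exact hA y (hw hy) (hw hx')
  have hconj : IsConj (σ * c * σ⁻¹ * c⁻¹) (t₁ * t₂) := by
    rw [isConj_iff_cycleType_eq, hdis.cycleType_mul, hd.cycleType_mul, cycleType_conj,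
      cycleType_inv, hcdef, cycleType_conj, cycleType_eq_of_involutions h1 h2 hc]
  obtain ⟨g, hg⟩ := isConj_iff.1 hconj
  exact ⟨g, c, u, by rw [hg, htu], hu⟩

end Perm

/-! ### Normal subgroups of the product -/

lemma normHamming_one_right {n : ℕ} (σ : Equiv.Perm (Fin n)) :
    normHamming σ 1 = (σ.support.card : ℝ) / n := rfl

lemma mem_nullSubgroup_of_card_support_le {k : ℕ → ℕ} (hk : Tendsto k atTop atTop) {u : SymProd k}
    (m : ℕ) (hu : ∀ n, (u n).support.card ≤ m) : u ∈ nullSubgroup k atTop := by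
  rw [mem_nullSubgroup_iff]
  refine squeeze_zero (fun n => normHamming_nonneg _ _) (fun n => ?_)
    ((tendsto_const_nhds (x := (m : ℝ))).div_atTop (tendsto_natCast_atTop_atTop.comp hk))
  rw [normHamming_one_right]
  simp only [Function.comp]
  gcongr
  exact_mod_cast hu n

lemma nullSubgroup_mono (k : ℕ → ℕ) {F F' : Filter ℕ} (h : F ≤ F') :
    nullSubgroup k F' ≤ nullSubgroup k F := fun _ ha =>
  mem_nullSubgroup_iff.2 ((mem_nullSubgroup_iff.1 ha).mono_left h)

section Normal

variable {k : ℕ → ℕ} {N : Subgroup (SymProd k)} [N.Normal]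

/-- A normal subgroup containing the null sequences contains all involutions whose support is at
most `2 ^ m / 3` times that of one of its members, by repeatedly halving the involution. -/
lemma involution_mem_of_support_le (hk : Tendsto k atTop atTop) (hN : nullSubgroup k atTop ≤ N)
    {a : SymProd k} (ha : a ∈ N) (m : ℕ) :
    ∀ t : SymProd k, t * t = 1 → (∀ n, 3 * (t n).support.card ≤ 2 ^ m * (a n).support.card) →
      t ∈ N := by
  induction m with
  | zero =>
    intro t ht h
    choose g c u htu hu using fun n =>
      exists_conj_commutator (a n) (t n) (congrFun ht n) (by simpa using h n)
    have e : t = g * (a * (c * a⁻¹ * c⁻¹)) * g⁻¹ * u := by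
      funext n
      simpa only [Pi.mul_apply, Pi.inv_apply, mul_assoc] using htu n
    rw [e]
    -- The commutator is the product of `a` and a conjugate of `a⁻¹`.
    exact N.mul_mem (‹N.Normal›.conj_mem _
      (N.mul_mem ha (‹N.Normal›.conj_mem _ (N.inv_mem ha) c)) g)
      (hN (mem_nullSubgroup_of_card_support_le hk 2 hu))
  | succ m ih =>
    intro t ht h
    choose t₁ t₂ u htu h1 h2 _ hc hle hu using fun n =>
      exists_split_involution (t n) (congrFun ht n)
    have e : t = t₁ * t₂ * u := funext htu
    rw [e]
    refine N.mul_mem (N.mul_mem (ih t₁ (funext h1) fun n => ?_) (ih t₂ (funext h2) fun n => ?_))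
      (hN (mem_nullSubgroup_of_card_support_le hk 2 hu))
    · have := h n
      have := hle n
      rw [pow_succ] at *
      linarith
    · have := h n
      have := hle n
      rw [← hc n]
      rw [pow_succ] at *
      linarith

lemma mem_of_support_le (hk : Tendsto k atTop atTop) (hN : nullSubgroup k atTop ≤ N)
    {a : SymProd k} (ha : a ∈ N) (m : ℕ) {g : SymProd k}
    (hg : ∀ n, 3 * (g n).support.card ≤ 2 ^ m * (a n).support.card) : g ∈ N := by
  choose ρ π hρ hπ hg' hfix using fun n => exists_involutions_mul_eq (g n)
  have e : g = ρ * π := funext hg'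
  rw [e]
  refine N.mul_mem (involution_mem_of_support_le hk hN ha m ρ (funext hρ) fun n => ?_)
    (involution_mem_of_support_le hk hN ha m π (funext hπ) fun n => ?_)
  · refine le_trans ?_ (hg n)
    gcongr
    intro x hx
    rw [Equiv.Perm.mem_support] at *
    exact fun h => hx (hfix n x h).1
  · refine le_trans ?_ (hg n)
    gcongr
    intro x hx
    rw [Equiv.Perm.mem_support] at *
    exact fun h => hx (hfix n x h).2

/-- If `a` lies in the normal subgroup `N`, then so does every sequence supported on a set of
indices along which `a` stays away from the identity. -/
lemma mem_of_support_subset (hk : Tendsto k atTop atTop) (hN : nullSubgroup k atTop ≤ N)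
    {a : SymProd k} (ha : a ∈ N) {ε : ℝ} (hε : 0 < ε) {g : SymProd k}
    (hg : ∀ n, normHamming (a n) 1 < ε → g n = 1) : g ∈ N := by
  obtain ⟨m, hm⟩ := pow_unbounded_of_one_lt (3 / ε) (one_lt_two (α := ℝ))
  refine mem_of_support_le hk hN ha m fun n => ?_
  by_cases h : normHamming (a n) 1 < ε
  · simp [hg n h]
  · rw [not_lt, normHamming_one_right] at h
    have hk0 : (0 : ℝ) < k n := by
      by_contra h0
      have h0 : (k n : ℝ) = 0 := le_antisymm (not_lt.1 h0) (Nat.cast_nonneg _)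
      rw [h0, div_zero] at h
      linarith
    rw [le_div_iff₀ hk0] at h
    rw [div_lt_iff₀ hε] at hm
    have h1 : ((g n).support.card : ℝ) ≤ k n := by
      exact_mod_cast (Finset.card_le_univ _).trans (by simp)
    have h2 : (3 * (g n).support.card : ℝ) ≤ 2 ^ m * (a n).support.card := by
      calc (3 * (g n).support.card : ℝ) ≤ 3 * k n := by gcongr
        _ ≤ (2 ^ m * ε) * k n := by gcongr
        _ = 2 ^ m * (ε * k n) := by ring
        _ ≤ _ := by gcongr
    exact_mod_cast h2

/-- Every proper normal subgroup containing the null sequences is contained in the kernel of some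
nonprincipal metric ultraproduct. The sets `S` such that `N` contains all sequences supported on
`S` form a proper ideal containing the finite sets, and any ultrafilter avoiding it will do. -/
lemma exists_le_nullSubgroup (hk : Tendsto k atTop atTop) (hN : nullSubgroup k atTop ≤ N)
    (hne : N ≠ ⊤) : ∃ U : Ultrafilter ℕ, (U : Filter ℕ) ≤ atTop ∧ N ≤ nullSubgroup k U := by
  classical
  let F : Filter ℕ :=
    { sets := {S | ∀ g : SymProd k, (∀ n ∈ S, g n = 1) → g ∈ N}
      univ_sets := fun g hg => by
        rw [show g = 1 from funext fun n => hg n (Set.mem_univ n)]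
        exact N.one_mem
      sets_of_superset := fun hS hST g hg => hS g fun n hn => hg n (hST hn)
      inter_sets := fun {S T} hS hT g hg => by
        have e : g = (fun n => if n ∈ S then 1 else g n) * (fun n => if n ∈ S then g n else 1) := by
          funext n
          by_cases h : n ∈ S <;> simp [h]
        rw [e]
        refine N.mul_mem (hS _ fun n hn => by simp [hn]) (hT _ fun n hn => ?_)
        by_cases h : n ∈ S
        · simpa [h] using hg n ⟨h, hn⟩
        · simp [h] }
  have hF : F.NeBot := by
    refine ⟨fun h => hne ?_⟩
    rw [eq_top_iff]
    intro g _
    have h1 : (∅ : Set ℕ) ∈ F := by rw [h]; exact mem_bot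
    exact h1 g (by simp)
  refine ⟨Ultrafilter.of F, (Ultrafilter.of_le F).trans ?_, fun a ha => ?_⟩
  · intro S hS g hg
    refine hN (mem_nullSubgroup_iff.2 (tendsto_const_nhds.congr' ?_))
    filter_upwards [hS] with n hn
    rw [hg n hn, normHamming_self]
  · rw [mem_nullSubgroup_iff, (nhds_basis_zero_abs_lt ℝ).tendsto_right_iff]
    intro ε hε
    refine Ultrafilter.of_le F fun g hg => mem_of_support_subset hk hN ha hε fun n hn => hg n ?_
    change |normHamming (a n) 1| < ε
    rwa [abs_of_nonneg (normHamming_nonneg _ _)]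

end Normal

/-! ### Stone duality for `𝒫(ℕ)/Fin` -/

lemma mem_boundary_iff {U : Ultrafilter ℕ} :
    U ∈ (Set.range (pure : ℕ → Ultrafilter ℕ))ᶜ ↔ (U : Filter ℕ) ≤ atTop := by
  rw [← Nat.cofinite_eq_atTop]
  constructor
  · intro h
    rcases U.le_cofinite_or_eq_pure with h1 | ⟨n, hn⟩
    · exact h1
    · exact absurd ⟨n, hn.symm⟩ h
  · rintro h ⟨n, rfl⟩
    have h1 : ({n}ᶜ : Set ℕ) ∈ (pure n : Ultrafilter ℕ) :=
      h (Set.finite_singleton n).compl_mem_cofinite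
    exact h1 rfl

lemma PowModFin.mk_le_mk_iff {S T : Set ℕ} :
    PowModFin.mk S ≤ PowModFin.mk T ↔ ∀ U : BetaBoundary, S ∈ U.1 → T ∈ U.1 := by
  have h : PowModFin.mk S ≤ PowModFin.mk T ↔ {n | n ∈ S → n ∈ T} ∈ (atTop : Filter ℕ) := by
    rw [← Nat.cofinite_eq_atTop]
    exact Germ.coe_le
  rw [h, mem_iff_ultrafilter]
  constructor
  · intro h U hS
    filter_upwards [h U.1 (mem_boundary_iff.1 U.2), hS] with n h1 h2 using h1 h2
  · intro h U hU
    rcases U.mem_or_compl_mem S with hS | hS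
    · filter_upwards [h ⟨U, mem_boundary_iff.2 hU⟩ hS] with n hn _ using hn
    · filter_upwards [hS] with n hn h1 using absurd h1 hn

lemma PowModFin.mk_eq_mk_iff {S T : Set ℕ} :
    PowModFin.mk S = PowModFin.mk T ↔ ∀ U : BetaBoundary, S ∈ U.1 ↔ T ∈ U.1 := by
  rw [le_antisymm_iff, mk_le_mk_iff, mk_le_mk_iff]
  exact ⟨fun h U => ⟨h.1 U, h.2 U⟩, fun h => ⟨fun U => (h U).1, fun U => (h U).2⟩⟩

lemma PowModFin.mk_surjective : Function.Surjective PowModFin.mk := fun x =>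
  Germ.inductionOn x fun f => ⟨{n | f n}, rfl⟩

lemma continuous_of_forall_exists_mem_iff {f : BetaBoundary → BetaBoundary}
    (hf : ∀ S : Set ℕ, ∃ T : Set ℕ, ∀ U, S ∈ (f U).1 ↔ T ∈ U.1) : Continuous f := by
  refine continuous_induced_rng.2 (ultrafilterBasis_is_basis.continuous_iff.2 ?_)
  rintro _ ⟨S, rfl⟩
  obtain ⟨T, hT⟩ := hf S
  have h : (Subtype.val ∘ f) ⁻¹' {u : Ultrafilter ℕ | S ∈ u} =
      Subtype.val ⁻¹' {u : Ultrafilter ℕ | T ∈ u} := Set.ext hT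
  rw [h]
  exact (ultrafilter_isOpen_basic T).preimage continuous_subtype_val

/-- A bijection of `∂βℕ` that, together with its inverse, pulls back the clopen sets given by
subsets of `ℕ` to such sets is a homeomorphism with a Stone dual. -/
lemma exists_isStoneDual (e : BetaBoundary ≃ BetaBoundary)
    (he : ∀ S : Set ℕ, ∃ T : Set ℕ, ∀ U, T ∈ (e U).1 ↔ S ∈ U.1)
    (he' : ∀ T : Set ℕ, ∃ S : Set ℕ, ∀ U, T ∈ (e U).1 ↔ S ∈ U.1) :
    ∃ (θ : BetaBoundary ≃ₜ BetaBoundary) (Θ : PowModFin ≃o PowModFin),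
      IsStoneDual θ Θ ∧ ∀ U, θ.symm U = e U := by
  choose T hT using he
  choose S hS using he'
  choose r hr using PowModFin.mk_surjective
  have hmem : ∀ (A : Set ℕ) (U : BetaBoundary), r (PowModFin.mk A) ∈ U.1 ↔ A ∈ U.1 := fun A U =>
    PowModFin.mk_eq_mk_iff.1 (hr (PowModFin.mk A)) U
  let Θ : PowModFin ≃o PowModFin :=
    { toFun := fun x => PowModFin.mk (T (r x))
      invFun := fun x => PowModFin.mk (S (r x))
      left_inv := fun x => by
        conv_rhs => rw [← hr x]
        exact PowModFin.mk_eq_mk_iff.2 fun U => by rw [← hS, hmem, hT]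
      right_inv := fun x => by
        conv_rhs => rw [← hr x]
        refine PowModFin.mk_eq_mk_iff.2 fun U => ?_
        rw [← e.apply_symm_apply U, hT, hmem, hS]
      map_rel_iff' := fun {x y} => by
        conv_rhs => rw [← hr x, ← hr y]
        change PowModFin.mk _ ≤ PowModFin.mk _ ↔ _
        rw [PowModFin.mk_le_mk_iff, PowModFin.mk_le_mk_iff]
        constructor
        · intro h U
          rw [← hT (r x), ← hT (r y)]
          exact h (e U)
        · intro h U
          rw [← e.apply_symm_apply U, hT, hT]
          exact h _ }
  let θ : BetaBoundary ≃ₜ BetaBoundary :=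
    { e.symm with
      continuous_toFun := continuous_of_forall_exists_mem_iff fun A =>
        ⟨T A, fun U => by
          rw [← e.apply_symm_apply U, hT]
          exact Iff.of_eq (congrArg (A ∈ ·.1) (e.symm_apply_apply _))⟩
      continuous_invFun := continuous_of_forall_exists_mem_iff fun A => ⟨S A, hS A⟩ }
  refine ⟨θ, Θ, fun A B hAB U => ?_, fun U => rfl⟩
  have h1 := PowModFin.mk_eq_mk_iff.1 hAB U
  rw [← h1]
  change _ ↔ A ∈ (e.symm U).1
  rw [← hmem A, ← hT _ (e.symm U), e.apply_symm_apply]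

/-! ### Ultraproduct kernels in the metric reduced product -/

/-- The kernel of the canonical map from `Sym[(kₙ)ₙ]` to the metric ultraproduct along `U`, for `U`
nonprincipal. -/
abbrev ultraKernel (k : ℕ → ℕ) (U : Ultrafilter ℕ) : Subgroup (ReducedProd k) :=
  (nullSubgroup k U).map (QuotientGroup.mk' (nullSubgroup k atTop))

lemma mk_mem_ultraKernel_iff {k : ℕ → ℕ} {U : Ultrafilter ℕ} (hU : (U : Filter ℕ) ≤ atTop)
    {a : SymProd k} :
    (QuotientGroup.mk a : ReducedProd k) ∈ ultraKernel k U ↔ a ∈ nullSubgroup k U := by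
  have h : (ultraKernel k U).comap (QuotientGroup.mk' (nullSubgroup k atTop)) =
      nullSubgroup k U := by
    rw [Subgroup.comap_map_eq, QuotientGroup.ker_mk', sup_eq_left]
    exact nullSubgroup_mono k hU
  conv_rhs => rw [← h]
  rfl

/-- The sequence with a fixed-point free permutation at the indices in `S` (as long as `2 ≤ kₙ`)
and the identity elsewhere. -/
noncomputable def rotateOn (k : ℕ → ℕ) (S : Set ℕ) : SymProd k :=
  open Classical in fun n => if n ∈ S then finRotate (k n) else 1

lemma rotateOn_mem_iff {k : ℕ → ℕ} (hk : Tendsto k atTop atTop) (S : Set ℕ) {U : Ultrafilter ℕ}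
    (hU : (U : Filter ℕ) ≤ atTop) : rotateOn k S ∈ nullSubgroup k U ↔ S ∉ U := by
  rw [mem_nullSubgroup_iff]
  constructor
  · intro h hS
    have h1 : ∀ᶠ n in (U : Filter ℕ), 2 ≤ k n := (hk.mono_left hU).eventually_ge_atTop 2
    have h2 : Tendsto (fun n => normHamming (rotateOn k S n) 1) U (𝓝 1) := by
      refine tendsto_const_nhds.congr' ?_
      filter_upwards [h1, hS] with n hn hnS
      rw [rotateOn, if_pos hnS, normHamming_one_right, support_finRotate_of_le hn]
      have : (k n : ℝ) ≠ 0 := by positivity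
      simp [this]
    exact zero_ne_one (tendsto_nhds_unique h h2)
  · intro hS
    refine tendsto_const_nhds.congr' ?_
    filter_upwards [Ultrafilter.compl_mem_iff_notMem.2 hS] with n hn
    rw [rotateOn, if_neg hn, normHamming_self]

lemma ultraKernel_injective {k : ℕ → ℕ} (hk : Tendsto k atTop atTop) {U U' : BetaBoundary}
    (h : ∀ x, x ∈ ultraKernel k U.1 → x ∈ ultraKernel k U'.1) : U = U' := by
  have hle : ∀ S ∈ U'.1, S ∈ U.1 := by
    intro S hS
    by_contra hn
    have h1 := h (QuotientGroup.mk (rotateOn k S))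
    rw [mk_mem_ultraKernel_iff (mem_boundary_iff.1 U.2),
      mk_mem_ultraKernel_iff (mem_boundary_iff.1 U'.2),
      rotateOn_mem_iff hk S (mem_boundary_iff.1 U.2),
      rotateOn_mem_iff hk S (mem_boundary_iff.1 U'.2)] at h1
    exact h1 hn hS
  exact Subtype.ext (Ultrafilter.coe_le_coe.1 hle)

lemma exists_map_ultraKernel_le {k l : ℕ → ℕ} (hk : Tendsto k atTop atTop)
    (hl : Tendsto l atTop atTop) (φ : ReducedProd k ≃* ReducedProd l) (U : BetaBoundary) :
    ∃ V : BetaBoundary, ∀ x, x ∈ ultraKernel k U.1 → φ x ∈ ultraKernel l V.1 := by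
  have hU := mem_boundary_iff.1 U.2
  let f : SymProd l →* ReducedProd k :=
    φ.symm.toMonoidHom.comp (QuotientGroup.mk' (nullSubgroup l atTop))
  have hf : ∀ b, f b = φ.symm (QuotientGroup.mk b) := fun _ => rfl
  have hnormal : (ultraKernel k U.1).Normal :=
    (nullSubgroup_normal k U.1).map _ (QuotientGroup.mk'_surjective _)
  have hN : nullSubgroup l atTop ≤ (ultraKernel k U.1).comap f := by
    intro b hb
    rw [Subgroup.mem_comap, hf, (QuotientGroup.eq_one_iff b).2 hb, map_one]
    exact Subgroup.one_mem _
  have hne : (ultraKernel k U.1).comap f ≠ ⊤ := by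
    intro h
    obtain ⟨b, hb⟩ := QuotientGroup.mk_surjective (φ (QuotientGroup.mk (rotateOn k Set.univ)))
    have h1 : b ∈ (ultraKernel k U.1).comap f := by rw [h]; exact Subgroup.mem_top _
    rw [Subgroup.mem_comap, hf, hb, φ.symm_apply_apply, mk_mem_ultraKernel_iff hU,
      rotateOn_mem_iff hk _ hU] at h1
    exact h1 univ_mem
  obtain ⟨V, hV, hle⟩ := exists_le_nullSubgroup hl hN hne
  refine ⟨⟨V, mem_boundary_iff.2 hV⟩, fun x hx => ?_⟩
  obtain ⟨b, hb⟩ := QuotientGroup.mk_surjective (φ x)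
  rw [← hb, mk_mem_ultraKernel_iff hV]
  apply hle
  rw [Subgroup.mem_comap, hf, hb, φ.symm_apply_apply]
  exact hx

/-- An isomorphism of metric reduced products permutes the kernels of the nonprincipal metric
ultraproducts: the image of such a kernel is a proper normal subgroup, hence is contained in
another one, and the same applies to the inverse. Distinct kernels are incomparable. -/
lemma exists_equiv_ultraKernel {k l : ℕ → ℕ} (hk : Tendsto k atTop atTop)
    (hl : Tendsto l atTop atTop) (φ : ReducedProd k ≃* ReducedProd l) :
    ∃ e : BetaBoundary ≃ BetaBoundary,
      ∀ U x, φ x ∈ ultraKernel l (e U).1 ↔ x ∈ ultraKernel k U.1 := by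
  choose e he using exists_map_ultraKernel_le hk hl φ
  choose e' he' using exists_map_ultraKernel_le hl hk φ.symm
  have h1 : Function.LeftInverse e' e := fun U =>
    (ultraKernel_injective hk fun x hx => by simpa using he' _ _ (he U x hx)).symm
  have h2 : Function.RightInverse e' e := fun U =>
    (ultraKernel_injective hl fun x hx => by simpa using he _ _ (he' U x hx)).symm
  refine ⟨⟨e, e', h1, h2⟩, fun U x => ⟨fun hx => ?_, he U x⟩⟩
  simpa [h1 U] using he' _ _ hx

/-- A bijection of `∂βℕ` matching the ultraproduct kernels maps clopen sets given by subsets of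
`ℕ` to such sets: the set `T` corresponding to `S` collects the indices at which the image of an
element supported on `S` dominates the image of one supported on the complement of `S`. -/
lemma exists_forall_mem_iff {k l : ℕ → ℕ} (hk : Tendsto k atTop atTop)
    (φ : ReducedProd k ≃* ReducedProd l) (e : BetaBoundary → BetaBoundary)
    (he : ∀ U x, φ x ∈ ultraKernel l (e U).1 ↔ x ∈ ultraKernel k U.1) (S : Set ℕ) :
    ∃ T : Set ℕ, ∀ U, T ∈ (e U).1 ↔ S ∈ U.1 := by
  obtain ⟨b, hb⟩ := QuotientGroup.mk_surjective (φ (QuotientGroup.mk (rotateOn k S)))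
  obtain ⟨c, hc⟩ := QuotientGroup.mk_surjective (φ (QuotientGroup.mk (rotateOn k Sᶜ)))
  refine ⟨{n | normHamming (c n) 1 < normHamming (b n) 1}, fun U => ?_⟩
  have hU := mem_boundary_iff.1 U.2
  have hV := mem_boundary_iff.1 (e U).2
  have h1 := he U (QuotientGroup.mk (rotateOn k S))
  have h2 := he U (QuotientGroup.mk (rotateOn k Sᶜ))
  rw [← hb, mk_mem_ultraKernel_iff hU, mk_mem_ultraKernel_iff hV, rotateOn_mem_iff hk _ hU,
    mem_nullSubgroup_iff] at h1
  rw [← hc, mk_mem_ultraKernel_iff hU, mk_mem_ultraKernel_iff hV, rotateOn_mem_iff hk _ hU,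
    mem_nullSubgroup_iff, Ultrafilter.compl_notMem_iff] at h2
  constructor
  · intro hT
    by_contra hS
    refine hS (h2.1 (squeeze_zero' (Eventually.of_forall fun n => normHamming_nonneg _ _) ?_
      (h1.2 hS)))
    filter_upwards [hT] with n hn using le_of_lt hn
  · intro hS
    by_contra hT
    refine h1.1 (squeeze_zero' (Eventually.of_forall fun n => normHamming_nonneg _ _) ?_
      (h2.2 hS)) hS
    filter_upwards [Ultrafilter.compl_mem_iff_notMem.2 hT] with n hn using not_lt.1 hn

/-- Equality on `S` is equality in all nonprincipal metric ultraproducts along ultrafilters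
containing `S`. -/
lemma eqOn_iff_forall_mem_ultraKernel {k : ℕ → ℕ} (S : Set ℕ) (a b : ReducedProd k) :
    EqOn S a b ↔ ∀ U : BetaBoundary, S ∈ U.1 → b⁻¹ * a ∈ ultraKernel k U.1 := by
  obtain ⟨a, rfl⟩ := QuotientGroup.mk_surjective a
  obtain ⟨b, rfl⟩ := QuotientGroup.mk_surjective b
  have h1 : EqOn S (QuotientGroup.mk a : ReducedProd k) (QuotientGroup.mk b) ↔
      Tendsto (fun n => normHamming (a n) (b n)) (atTop ⊓ 𝓟 S) (𝓝 0) :=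
    limsup_normHamming_eq_zero_iff _ a b
  have h2 : ∀ n, normHamming ((b⁻¹ * a) n) 1 = normHamming (a n) (b n) := fun n => by
    have := normHamming_mul_left (b n) ((b n)⁻¹ * a n) 1
    simpa using this.symm
  have h3 : ∀ U : BetaBoundary, (QuotientGroup.mk b : ReducedProd k)⁻¹ * QuotientGroup.mk a ∈
      ultraKernel k U.1 ↔ Tendsto (fun n => normHamming (a n) (b n)) U.1 (𝓝 0) := fun U => by
    rw [← QuotientGroup.mk_inv, ← QuotientGroup.mk_mul,
      mk_mem_ultraKernel_iff (mem_boundary_iff.1 U.2), mem_nullSubgroup_iff]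
    simp only [h2]
  rw [h1, tendsto_iff_ultrafilter]
  constructor
  · intro h U hS
    exact (h3 U).2 (h U.1 (le_inf (mem_boundary_iff.1 U.2) (le_principal_iff.2 hS)))
  · intro h U hU
    obtain ⟨hU1, hU2⟩ := le_inf_iff.1 hU
    exact (h3 ⟨U, mem_boundary_iff.2 hU1⟩).1 (h _ (le_principal_iff.1 hU2))

/-- An isomorphism of metric reduced products matching two ultraproduct kernels induces an
isomorphism of the metric ultraproducts. -/
lemma exists_ultraProd_mulEquiv {k l : ℕ → ℕ} (φ : ReducedProd k ≃* ReducedProd l)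
    (U V : BetaBoundary) (h : ∀ x, φ x ∈ ultraKernel l V.1 ↔ x ∈ ultraKernel k U.1) :
    ∃ φU : UltraProd k U.1 ≃* UltraProd l V.1, ∀ (a : SymProd k) (b : SymProd l),
      φ (QuotientGroup.mk a) = QuotientGroup.mk b →
        φU (QuotientGroup.mk a) = QuotientGroup.mk b := by
  have hmap : (ultraKernel k U.1).map (φ : ReducedProd k →* ReducedProd l) =
      ultraKernel l V.1 := by
    ext y
    constructor
    · rintro ⟨x, hx, rfl⟩
      exact (h x).2 hx
    · exact fun hy => ⟨φ.symm y, (h _).1 (by rwa [φ.apply_symm_apply]), φ.apply_symm_apply y⟩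
  let ek := QuotientGroup.quotientQuotientEquivQuotient (nullSubgroup k atTop) (nullSubgroup k U.1)
    (nullSubgroup_mono k (mem_boundary_iff.1 U.2))
  let el := QuotientGroup.quotientQuotientEquivQuotient (nullSubgroup l atTop) (nullSubgroup l V.1)
    (nullSubgroup_mono l (mem_boundary_iff.1 V.2))
  refine ⟨(ek.symm.trans (QuotientGroup.congr _ _ φ hmap)).trans el, fun a b hab => ?_⟩
  change el (QuotientGroup.mk (φ (QuotientGroup.mk a))) = QuotientGroup.mk b
  rw [hab]
  rfl

end SymReduced

theorem mainTheorem2 (k l : ℕ → ℕ) (hk : Tendsto k atTop atTop) (hl : Tendsto l atTop atTop)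
    (φ : SymReduced.ReducedProd k ≃* SymReduced.ReducedProd l) :
    ∃ (θ : SymReduced.BetaBoundary ≃ₜ SymReduced.BetaBoundary)
      (Θ : SymReduced.PowModFin ≃o SymReduced.PowModFin),
      SymReduced.IsStoneDual θ Θ ∧
      (∀ (a b : SymReduced.ReducedProd k) (S T : Set ℕ), S.Infinite →
        Θ (SymReduced.PowModFin.mk S) = SymReduced.PowModFin.mk T →
          (SymReduced.EqOn S a b ↔ SymReduced.EqOn T (φ a) (φ b))) ∧
      (∀ U : SymReduced.BetaBoundary,
        ∃ φU : SymReduced.UltraProd k U.1 ≃* SymReduced.UltraProd l (θ.symm U).1,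
          ∀ (a : SymReduced.SymProd k) (b : SymReduced.SymProd l),
            φ (QuotientGroup.mk a) = QuotientGroup.mk b →
              φU (QuotientGroup.mk a) = QuotientGroup.mk b) := by
  obtain ⟨e, he⟩ := SymReduced.exists_equiv_ultraKernel hk hl φ
  have he' : ∀ V y, φ.symm y ∈ SymReduced.ultraKernel k (e.symm V).1 ↔
      y ∈ SymReduced.ultraKernel l V.1 := fun V y => by
    rw [← he, e.apply_symm_apply, φ.apply_symm_apply]
  obtain ⟨θ, Θ, hdual, hθ⟩ := SymReduced.exists_isStoneDual e
    (SymReduced.exists_forall_mem_iff hk φ e he) fun T => by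
      obtain ⟨S, hS⟩ := SymReduced.exists_forall_mem_iff hl φ.symm e.symm he' T
      exact ⟨S, fun U => by rw [← hS (e U), e.symm_apply_apply]⟩
  refine ⟨θ, Θ, hdual, fun a b S T _ hST => ?_, fun U => ?_⟩
  · have hmem : ∀ U, T ∈ (e U).1 ↔ S ∈ U.1 := fun U => by
      rw [← hθ, hdual S T hST, θ.apply_symm_apply]
    rw [SymReduced.eqOn_iff_forall_mem_ultraKernel, SymReduced.eqOn_iff_forall_mem_ultraKernel]
    refine ⟨fun h V hV => ?_, fun h U hS => ?_⟩
    · obtain ⟨U, rfl⟩ := e.surjective V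
      rw [← map_inv, ← map_mul, he]
      exact h U ((hmem U).1 hV)
    · rw [← he, map_mul, map_inv]
      exact h (e U) ((hmem U).2 hS)
  · exact SymReduced.exists_ultraProd_mulEquiv φ U (θ.symm U) (by rw [hθ]; exact he U)
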